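/- Let $X_1,X_2,\dots$ and $\varepsilon_1,\varepsilon_2,\dots$ be independent real random variables, the $\varepsilon_i$ with known Lebesgue density $h$ such that $E\varepsilon_i=0$ and $0<E\varepsilon_i^2<\infty$, and observe $Y_i=X_i+\varepsilon_i$. Let $f_0$ be a known probability density and let $H_0$ be the hypothesis that every $X_i$ has density $f_0$. Fix $d\ge 1$. For every $k=1,\dots,d$ let $\{f^{(k)}_\theta:\theta\in\Theta_k\}$ be a family of probability densities on $\mathbb{R}$, where $\Theta_k\subseteq\mathbb{R}^k$ is open, $0\in\Theta_k$ and $f^{(k)}_0=f_0$ almost everywhere (this includes nested families of submodels $\Theta_1\subset\Theta_2\subset\dots\subset\Theta_d$). Put $$q_k(y;\theta)=\int_{\mathbb{R}} f^{(k)}_\theta(s)\,h(y-s)\,ds,\qquad dQ_{k,\theta}=q_k(\cdot\,;\theta)\,d\lambda,$$ $$\dot l_k(y;\theta)=\frac{\nabla_\theta\, q_k(y;\theta)}{q_k(y;\theta)}\,1_{[q_k(y;\theta)>0]},\qquad I_k(\theta)=\int_{\mathbb{R}}\dot l_k(y;\theta)\,\dot l_k(y;\theta)^T\,dQ_{k,\theta}(y),$$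 where $\lambda$ is Lebesgue measure. Assume that for every $k=1,\dots,d$: (B1) for $\lambda$-almost every $y$, the function $\theta\mapsto q_k(y;\theta)$ is continuously differentiable on $\Theta_k$; (B2) $|\dot l_k(\cdot\,;\theta)|\in L_2(\mathbb{R},Q_{k,\theta})$ for all $\theta\in\Theta_k$; (B3) $I_k(\theta)$ is nonsingular for all $\theta\in\Theta_k$ and continuous in $\theta$ on $\Theta_k$. For a sample of size $n$ let $$U_k=\Bigl\{\frac1{\sqrt n}\sum_{j=1}^n \dot l_k(Y_j;0)\Bigr\}^{T} I_k(0)^{-1}\Bigl\{\frac1{\sqrt n}\sum_{j=1}^n \dot l_k(Y_j;0)\Bigr\}.$$ Let $\pi(j,n)$ be real numbers such that $\pi(1,n)<\pi(2,n)<\dots<\pi(d,n)$ for all $n\ge1$ and $\pi(j,n)-\pi(1,n)\to\infty$ as $n\to\infty$ for every $j=2,\dots,d$, and let $$S=\min\bigl\{k:\ 1\le k\le d,\ U_k-\pi(k,n)\ge U_j-\pi(j,n)\ \text{ for all } j=1,\dots,d\bigr\}.$$ Then, under $H_0$, as $n\to\infty$, $$P_0(S>1)\to 0\qquad\text{and}\qquad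 U_S\to_d\chi^2_1 ,$$ where $\chi^2_1$ is the chi-square distribution with one degree of freedom. -/

import Mathlib

open MeasureTheory ProbabilityTheory Filter Topology
open scoped Matrix

noncomputable section

namespace ScoreDeconvolution

/-- A probability density on the real line with respect to Lebesgue measure. -/
structure IsDensity (g : ℝ → ℝ) : Prop where
  measurable : Measurable g
  nonneg : ∀ x, 0 ≤ g x
  integrable : Integrable g volume
  integral_eq_one : ∫ x, g x = 1

/-- The measure on the real line with Lebesgue density `g`. -/
def law (g : ℝ → ℝ) : Measure ℝ :=
  volume.withDensity fun x => ENNReal.ofReal (g x)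

/-- A noise density: a probability density with mean zero and finite positive variance. -/
structure IsNoiseDensity (h : ℝ → ℝ) : Prop extends IsDensity h where
  integrable_sq : Integrable (fun x => x ^ 2 * h x) volume
  mean_zero : ∫ x, x * h x = 0
  second_moment_pos : 0 < ∫ x, x ^ 2 * h x

section Model

variable {k : ℕ} (f : EuclideanSpace ℝ (Fin k) → ℝ → ℝ) (h : ℝ → ℝ)

/-- The density `q(y; θ) = ∫ f_θ(s) h(y - s) ds` of an observation `Y = X + ε`. -/
def obsDensity (θ : EuclideanSpace ℝ (Fin k)) (y : ℝ) : ℝ :=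
  ∫ s, f θ s * h (y - s)

/-- The distribution `Q_θ` of an observation. -/
def obsLaw (θ : EuclideanSpace ℝ (Fin k)) : Measure ℝ :=
  law (obsDensity f h θ)

open Classical in
/-- The score function: gradient of `q(y; θ)` in `θ`, divided by `q(y; θ)`, on `q(y; θ) > 0`,
and zero elsewhere. -/
def score (θ : EuclideanSpace ℝ (Fin k)) (y : ℝ) : EuclideanSpace ℝ (Fin k) :=
  if 0 < obsDensity f h θ y then
    (obsDensity f h θ y)⁻¹ • gradient (fun η => obsDensity f h η y) θ
  else 0

/-- The Fisher information matrix `I(θ)`, with entries the `Q_θ`-integrals of the products of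
the coordinates of the score. -/
def fisherInformation (θ : EuclideanSpace ℝ (Fin k)) : Matrix (Fin k) (Fin k) ℝ :=
  Matrix.of fun i j => ∫ y, score f h θ y i * score f h θ y j ∂(obsLaw f h θ)

/-- A regular deconvolution problem with parameter set `Θ`. -/
structure IsRegular (Θ : Set (EuclideanSpace ℝ (Fin k))) : Prop where
  /-- B1: for almost all `y`, the map `θ ↦ q(y; θ)` is continuously differentiable on `Θ`. -/
  contDiffOn : ∀ᵐ y ∂(volume : Measure ℝ), ContDiffOn ℝ 1 (fun θ => obsDensity f h θ y) Θ
  /-- B2: the score is square integrable. -/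
  memLp_score : ∀ θ ∈ Θ, MemLp (score f h θ) 2 (obsLaw f h θ)
  /-- B3: the Fisher information is nonsingular on `Θ`. -/
  nonsingular : ∀ θ ∈ Θ, IsUnit (fisherInformation f h θ).det
  /-- B3: the Fisher information is continuous on `Θ`. -/
  continuousOn : ContinuousOn (fisherInformation f h) Θ

/-- The normalized sum `n^{-1/2} ∑_{j ≤ n} l*(y_j)` of the scores at `θ = 0`; the observations
`y_1, …, y_n` are `y 0, …, y (n - 1)`. -/
def normalizedScore (n : ℕ) (y : ℕ → ℝ) : Fin k → ℝ :=
  fun i => (Real.sqrt n)⁻¹ * ∑ j ∈ Finset.range n, score f h 0 (y j) i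

/-- The score test statistic `U_k`: the quadratic form of `L = I(0)⁻¹` at the normalized sum. -/
def scoreStatistic (n : ℕ) (y : ℕ → ℝ) : ℝ :=
  normalizedScore f h n y ⬝ᵥ ((fisherInformation f h 0)⁻¹ *ᵥ normalizedScore f h n y)

end Model

/-- A penalty for the models `1, …, d`: strictly increasing in the model index for every sample
size `n ≥ 1`, with all differences `π(j, n) - π(1, n)`, `2 ≤ j ≤ d`, tending to infinity. -/
structure IsPenalty (d : ℕ) (pen : ℕ → ℕ → ℝ) : Prop where
  strictMono : ∀ n, 1 ≤ n → ∀ i j, 1 ≤ i → i < j → j ≤ d → pen i n < pen j n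
  tendsto_atTop : ∀ j, 2 ≤ j → j ≤ d → Tendsto (fun n => pen j n - pen 1 n) atTop atTop

/-- The indices `1 ≤ k ≤ d` at which the penalized statistic `u k - p k` is maximal. -/
def maximizers (d : ℕ) (u p : ℕ → ℝ) : Set ℕ :=
  {k | 1 ≤ k ∧ k ≤ d ∧ ∀ j, 1 ≤ j → j ≤ d → u j - p j ≤ u k - p k}

/-- The selected index: the smallest maximizer of the penalized statistic. -/
def selection (d : ℕ) (u p : ℕ → ℝ) : ℕ := sInf (maximizers d u p)

/-- For `d ≥ 1` there is a maximizer, so the infimum defining the selected index is a minimum. -/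
theorem selection_isLeast {d : ℕ} (hd : 1 ≤ d) (u p : ℕ → ℝ) :
    IsLeast (maximizers d u p) (selection d u p) := by
  have hne : (maximizers d u p).Nonempty := by
    obtain ⟨k, hk, hmax⟩ := Finset.exists_max_image (Finset.Icc 1 d) (fun j => u j - p j)
      ⟨1, Finset.mem_Icc.2 ⟨le_rfl, hd⟩⟩
    rw [Finset.mem_Icc] at hk
    exact ⟨k, hk.1, hk.2, fun j h1 h2 => hmax j (Finset.mem_Icc.2 ⟨h1, h2⟩)⟩
  exact ⟨Nat.sInf_mem hne, fun k hk => Nat.sInf_le hk⟩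

/-- The central chi-square distribution with `k` degrees of freedom: the law of the sum of the
squares of `k` independent standard normal variables. -/
def chiSquare (k : ℕ) : Measure ℝ :=
  (Measure.pi fun _ : Fin k => gaussianReal 0 1).map fun z => ∑ i, z i ^ 2

instance isProbabilityMeasure_chiSquare (k : ℕ) : IsProbabilityMeasure (chiSquare k) :=
  Measure.isProbabilityMeasure_map (Measurable.aemeasurable (by fun_prop))

/-- Under the null hypothesis: signals `X_i` with density `f₀` and noises `ε_i` with density `h`,
all of them independent (the pairs are independent, and within each pair too). -/
structure IsNullModel {Ω : Type*} [MeasurableSpace Ω] (P : Measure Ω) (f₀ h : ℝ → ℝ)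
    (X ε : ℕ → Ω → ℝ) : Prop where
  law_signal : ∀ i, HasLaw (X i) (law f₀) P
  law_noise : ∀ i, HasLaw (ε i) (law h) P
  indep_pairs : iIndepFun (fun i ω => (X i ω, ε i ω)) P
  indep_signal_noise : ∀ i, IndepFun (X i) (ε i) P

section DataDriven

variable (f : (k : ℕ) → EuclideanSpace ℝ (Fin k) → ℝ → ℝ) (h : ℝ → ℝ) (d : ℕ)
  (pen : ℕ → ℕ → ℝ)

/-- The selection rule `S` computed from the observations `y_1, …, y_n`. -/
def selectionRule (n : ℕ) (y : ℕ → ℝ) : ℕ :=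
  selection d (fun k => scoreStatistic (f k) h n y) (fun k => pen k n)

/-- The data-driven statistic `U_S`. -/
def dataDrivenStatistic (n : ℕ) (y : ℕ → ℝ) : ℝ :=
  scoreStatistic (f (selectionRule f h d pen n y)) h n y

end DataDriven

end ScoreDeconvolution

end

/-! Everything rests on the scores at `0` being centered under the null law
(`IsRegular.integral_score_eq_zero`). Differentiation under the integral is not assumed; it is
recovered from continuity of the Fisher information. Along a path of densities `q t` with derivative
`D t`, one has `|D| ≤ D²/q + q`, and the integral of this bound is an information term plus the
total mass, hence continuous in `t`. Generalized dominated convergence makes `t ↦ ∫ D t` continuous,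
while by Fubini its primitive is `∫ (q s - q 0) = 0`; so it vanishes.

Centered i.i.d. scores give normalized sums with bounded second moments, so each `U_k` is bounded in
L¹ uniformly in `n`. If `S = k > 1`, comparison with model 1 and `U_1 ≥ 0` force `U_k ≥ π(k,n) -
π(1,n)`; since this threshold diverges, Markov's inequality and a union bound give `P(S > 1) → 0`.
Finally `U_S = U_1` off that event, and `U_1` is the square of a standardized sum, so the central
limit theorem and Slutsky's lemma conclude. -/

namespace ScoreDeconvolution

/-! ### Differentiating the total mass along a path of densities -/

/-- Dominated convergence with varying bounds `G i`, which need to converge to the bound `G₀`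
only from below. -/
theorem tendsto_integral_of_tendsto_integral_bound {α ι : Type*} [MeasurableSpace α]
    {μ : Measure α} {l : Filter ι} [l.IsCountablyGenerated] {F G : ι → α → ℝ} {F₀ G₀ : α → ℝ}
    (hF : ∀ i, Integrable (F i) μ) (hG : ∀ i, Integrable (G i) μ) (hG₀ : Integrable G₀ μ)
    (hFG : ∀ i y, |F i y| ≤ G i y) (hFG₀ : ∀ y, |F₀ y| ≤ G₀ y)
    (hlimF : ∀ y, Tendsto (fun i => F i y) l (𝓝 (F₀ y)))
    (hlimG : ∀ y, Tendsto (fun i => min (G i y) (G₀ y)) l (𝓝 (G₀ y)))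
    (hint : Tendsto (fun i => ∫ y, G i y ∂μ) l (𝓝 (∫ y, G₀ y ∂μ))) :
    Tendsto (fun i => ∫ y, F i y ∂μ) l (𝓝 (∫ y, F₀ y ∂μ)) := by
  have hG0 : ∀ y, 0 ≤ G₀ y := fun y => (abs_nonneg _).trans (hFG₀ y)
  have hGn : ∀ i y, 0 ≤ G i y := fun i y => (abs_nonneg _).trans (hFG i y)
  have hmin : ∀ i, Integrable (fun y => min (G i y) (G₀ y)) μ := fun i => (hG i).inf hG₀
  have hclip : ∀ i, Integrable (fun y => max (-G₀ y) (min (F i y) (G₀ y))) μ :=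
    fun i => hG₀.neg.sup ((hF i).inf hG₀)
  have h1 : Tendsto (fun i => ∫ y, min (G i y) (G₀ y) ∂μ) l (𝓝 (∫ y, G₀ y ∂μ)) := by
    refine tendsto_integral_filter_of_dominated_convergence G₀
      (Eventually.of_forall fun i => (hmin i).aestronglyMeasurable)
      (Eventually.of_forall fun i => ae_of_all _ fun y => ?_) hG₀ (ae_of_all _ hlimG)
    rw [Real.norm_eq_abs, abs_of_nonneg (le_min (hGn i y) (hG0 y))]
    exact min_le_right _ _
  have h2 : Tendsto (fun i => ∫ y, max (-G₀ y) (min (F i y) (G₀ y)) ∂μ) l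
      (𝓝 (∫ y, F₀ y ∂μ)) := by
    refine tendsto_integral_filter_of_dominated_convergence G₀
      (Eventually.of_forall fun i => (hclip i).aestronglyMeasurable)
      (Eventually.of_forall fun i => ae_of_all _ fun y => ?_) hG₀ (ae_of_all _ fun y => ?_)
    · rw [Real.norm_eq_abs, abs_le]
      exact ⟨le_max_left _ _, max_le (by linarith [hG0 y]) (min_le_right _ _)⟩
    · have := abs_le.1 (hFG₀ y)
      have h3 : Tendsto (fun i => max (-G₀ y) (min (F i y) (G₀ y))) l
          (𝓝 (max (-G₀ y) (min (F₀ y) (G₀ y)))) :=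
        tendsto_const_nhds.max ((hlimF y).min tendsto_const_nhds)
      rwa [min_eq_left this.2, max_eq_right this.1] at h3
  -- Clipping `F i` to `[-G₀, G₀]` changes it by at most `G i - min (G i) G₀`, whose integral tends
  -- to `0` by `hint` and `h1`.
  have h3 : Tendsto (fun i => (∫ y, F i y ∂μ) - ∫ y, max (-G₀ y) (min (F i y) (G₀ y)) ∂μ) l
      (𝓝 0) := by
    have h4 := hint.sub h1
    rw [sub_self] at h4
    refine squeeze_zero_norm (fun i => ?_) h4
    rw [← integral_sub (hF i) (hclip i), ← integral_sub (hG i) (hmin i)]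
    refine norm_integral_le_of_norm_le ((hG i).sub (hmin i)) (ae_of_all _ fun y => ?_)
    have := abs_le.1 (hFG i y)
    have := hG0 y
    rw [Real.norm_eq_abs, abs_le]
    rcases min_cases (F i y) (G₀ y) with ⟨e, _⟩ | ⟨e, _⟩ <;>
    rcases min_cases (G i y) (G₀ y) with ⟨e', _⟩ | ⟨e', _⟩ <;>
    rw [e, e'] <;>
    rcases max_cases (-G₀ y) (F i y) with ⟨e'', _⟩ | ⟨e'', _⟩ <;>
    rcases max_cases (-G₀ y) (G₀ y) with ⟨e3, _⟩ | ⟨e3, _⟩ <;>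
    simp only [e'', e3] <;> constructor <;> linarith
  simpa using h3.add h2

theorem hasDerivAt_eq_zero_of_nonneg {q : ℝ → ℝ} (hq : ∀ t, 0 ≤ q t) {D t : ℝ}
    (h : HasDerivAt q D t) (h0 : q t = 0) : D = 0 :=
  IsLocalMin.hasDerivAt_eq_zero (Eventually.of_forall fun s => h0.trans_le (hq s)) h

/-- An AM-GM bound; at `q = 0` the quotient is `0` by convention, hence `h0`. -/
theorem abs_le_sq_div_add {D q : ℝ} (hq : 0 ≤ q) (h0 : q = 0 → D = 0) :
    |D| ≤ D ^ 2 / q + q := by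
  rcases hq.eq_or_lt with h | h
  · simp [h0 h.symm, ← h]
  · rw [div_add' _ _ _ h.ne', le_div_iff₀ h, ← sq_abs D]
    nlinarith [sq_nonneg (|D| - q), sq_nonneg (|D| + q), abs_nonneg D]

/-- In a smooth path of probability densities with continuous Fisher information, the derivative
integrates to zero. -/
theorem integral_deriv_eq_zero {α : Type*} [MeasurableSpace α] {μ : Measure α} [SFinite μ]
    {q D : ℝ → α → ℝ}
    (hq : ∀ t, Measurable (q t)) (hq0 : ∀ t y, 0 ≤ q t y) (hqint : ∀ t, Integrable (q t) μ)
    {c : ℝ} (hq1 : ∀ t, ∫ y, q t y ∂μ = c)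
    (hD : ∀ t y, HasDerivAt (fun s => q s y) (D t y) t)
    (hDc : ∀ y, Continuous fun t => D t y)
    (hJint : ∀ t, Integrable (fun y => D t y ^ 2 / q t y) μ)
    (hJ : Continuous fun t => ∫ y, D t y ^ 2 / q t y ∂μ) :
    ∫ y, D 0 y ∂μ = 0 := by
  have hz : ∀ t y, q t y = 0 → D t y = 0 := fun t y h =>
    hasDerivAt_eq_zero_of_nonneg (fun s => hq0 s y) (hD t y) h
  -- Each `D t` is a pointwise limit of measurable difference quotients.
  have hDm : ∀ t, Measurable (D t) := by
    intro t
    have hlim : Tendsto (fun n : ℕ => t + 1 / ((n : ℝ) + 1)) atTop (𝓝[≠] t) := by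
      refine tendsto_nhdsWithin_iff.2 ⟨?_, Eventually.of_forall fun n => ?_⟩
      · simpa using tendsto_const_nhds.add (tendsto_one_div_add_atTop_nhds_zero_nat (𝕜 := ℝ))
      · have : 0 < 1 / ((n : ℝ) + 1) := by positivity
        simpa using this.ne'
    refine measurable_of_tendsto_metrizable
      (f := fun (n : ℕ) y => slope (fun s => q s y) t (t + 1 / ((n : ℝ) + 1))) (fun n => ?_) ?_
    · simp only [slope_def_field]
      exact ((hq _).sub (hq _)).div_const _
    · exact tendsto_pi_nhds.2 fun y => (hasDerivAt_iff_tendsto_slope.1 (hD t y)).comp hlim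
  have hDuc : Measurable (Function.uncurry D) := measurable_uncurry_of_continuous_of_measurable hDc hDm
  set G : ℝ → α → ℝ := fun t y => D t y ^ 2 / q t y + q t y with hGdef
  have hDG : ∀ t y, |D t y| ≤ G t y := fun t y => abs_le_sq_div_add (hq0 t y) (hz t y)
  have hGint : ∀ t, Integrable (G t) μ := fun t => (hJint t).add (hqint t)
  have hDint : ∀ t, Integrable (D t) μ := fun t =>
    (hGint t).mono' (hDm t).aestronglyMeasurable (ae_of_all _ (hDG t))
  have hGc : Continuous fun t => ∫ y, G t y ∂μ := by
    have : (fun t => ∫ y, G t y ∂μ) = fun t => (∫ y, D t y ^ 2 / q t y ∂μ) + c := by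
      funext t
      rw [← hq1 t, ← integral_add (hJint t) (hqint t)]
    rw [this]
    exact hJ.add continuous_const
  have hm : Continuous fun t => ∫ y, D t y ∂μ := by
    refine continuous_iff_continuousAt.2 fun t₀ => ?_
    refine tendsto_integral_of_tendsto_integral_bound hDint hGint (hGint t₀) hDG (hDG t₀)
      (fun y => (hDc y).tendsto t₀) (fun y => ?_) (hGc.tendsto t₀)
    -- Where `q t₀ y = 0` the quotient `D²/q` need not be continuous at `t₀`, but then `G t₀ y = 0`
    -- and the one-sided convergence is trivial.
    rcases (hq0 t₀ y).eq_or_lt with h | h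
    · have h0 : G t₀ y = 0 := by simp [hGdef, ← h]
      rw [h0]
      refine tendsto_const_nhds.congr fun t => ?_
      rw [min_eq_right ((abs_nonneg _).trans (hDG t y))]
    · have hqc : ContinuousAt (fun t => q t y) t₀ := (hD t₀ y).continuousAt
      have : Tendsto (fun t => G t y) (𝓝 t₀) (𝓝 (G t₀ y)) :=
        ((((hDc y).continuousAt (x := t₀)).pow 2).div hqc h.ne').add hqc
      simpa using this.min (tendsto_const_nhds (x := G t₀ y))
  have hprim : ∀ s : ℝ, ∫ t in (0 : ℝ)..s, ∫ y, D t y ∂μ = 0 := by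
    intro s
    have hint : Integrable (Function.uncurry D)
        ((volume.restrict (Set.uIoc 0 s)).prod μ) := by
      rw [integrable_prod_iff hDuc.aestronglyMeasurable]
      refine ⟨ae_of_all _ hDint, ?_⟩
      have hGi : Integrable (fun t => ∫ y, G t y ∂μ) (volume.restrict (Set.uIoc 0 s)) :=
        intervalIntegrable_iff.1 (hGc.intervalIntegrable 0 s)
      refine hGi.mono' hDuc.aestronglyMeasurable.norm.integral_prod_right' (ae_of_all _ fun t => ?_)
      rw [Real.norm_eq_abs, abs_of_nonneg (integral_nonneg fun y => norm_nonneg _)]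
      exact integral_mono (hDint t).norm (hGint t) (hDG t)
    rw [intervalIntegral_integral_swap hint]
    have : ∀ y, ∫ t in (0 : ℝ)..s, D t y = q s y - q 0 y := fun y =>
      intervalIntegral.integral_eq_sub_of_hasDerivAt (fun t _ => hD t y)
        ((hDc y).intervalIntegrable 0 s)
    simp only [this]
    rw [integral_sub (hqint s) (hqint 0), hq1, hq1, sub_self]
  -- A continuous function is the derivative of its primitive, here identically `0`.
  have h1 := hm.deriv_integral _ 0 0
  simp only [hprim, deriv_const] at h1
  exact h1.symm

/-- The version of `integral_deriv_eq_zero` for paths that are smooth at almost all points. -/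
theorem integral_deriv_eq_zero_of_ae {α : Type*} [MeasurableSpace α] {μ : Measure α} [SFinite μ]
    {q D : ℝ → α → ℝ}
    (hq : ∀ t, Measurable (q t)) (hq0 : ∀ t y, 0 ≤ q t y) (hqint : ∀ t, Integrable (q t) μ)
    {c : ℝ} (hq1 : ∀ t, ∫ y, q t y ∂μ = c)
    (hD : ∀ᵐ y ∂μ, (∀ t, HasDerivAt (fun s => q s y) (D t y) t) ∧ Continuous fun t => D t y)
    (hJint : ∀ t, Integrable (fun y => D t y ^ 2 / q t y) μ)
    (hJ : Continuous fun t => ∫ y, D t y ^ 2 / q t y ∂μ) :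
    ∫ y, D 0 y ∂μ = 0 := by
  -- Setting `q` and `D` to zero off a measurable conull set makes the path smooth everywhere and
  -- changes no integral.
  obtain ⟨A, hA, hAm, hAp⟩ : ∃ A : Set α, A ∈ ae μ ∧ MeasurableSet A ∧
      ∀ y ∈ A, (∀ t, HasDerivAt (fun s => q s y) (D t y) t) ∧ Continuous fun t => D t y := by
    obtain ⟨A, hAs, hAm, hA⟩ := exists_measurable_superset_of_null hD
    refine ⟨Aᶜ, by simpa [mem_ae_iff] using hA, hAm.compl, fun y hy => ?_⟩
    by_contra hcon
    exact hy (hAs hcon)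
  have hAq : ∀ t, A.indicator (q t) =ᵐ[μ] q t := fun t => by
    filter_upwards [hA] with y hy using Set.indicator_of_mem hy _
  have hAD : ∀ t, A.indicator (D t) =ᵐ[μ] D t := fun t => by
    filter_upwards [hA] with y hy using Set.indicator_of_mem hy _
  have hAJ : ∀ t, (fun y => A.indicator (D t) y ^ 2 / A.indicator (q t) y) =ᵐ[μ]
      fun y => D t y ^ 2 / q t y := fun t => by
    filter_upwards [hA] with y hy
    simp [hy]
  rw [← integral_congr_ae (hAD 0)]
  refine integral_deriv_eq_zero (q := fun t => A.indicator (q t)) (D := fun t => A.indicator (D t))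
    (c := c) (fun t => (hq t).indicator hAm) (fun t y => Set.indicator_nonneg (fun y _ => hq0 t y) y)
    (fun t => (hqint t).congr (hAq t).symm) (fun t => by rw [integral_congr_ae (hAq t), hq1])
    (fun t y => ?_) (fun y => ?_) (fun t => (hJint t).congr (hAJ t).symm) ?_
  · by_cases hy : y ∈ A
    · simpa [hy] using (hAp y hy).1 t
    · simpa [hy] using hasDerivAt_const t (0 : ℝ)
  · by_cases hy : y ∈ A
    · simpa [hy] using (hAp y hy).2
    · simpa [hy] using continuous_const
  · simpa only [integral_congr_ae (hAJ _)] using hJ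


/-! ### Laws with densities and their convolution -/

theorem integral_law {g : ℝ → ℝ} (hg : Measurable g) (hg0 : ∀ x, 0 ≤ g x) (φ : ℝ → ℝ) :
    ∫ x, φ x ∂law g = ∫ x, g x * φ x := by
  rw [law, integral_withDensity_eq_integral_toReal_smul hg.ennreal_ofReal
    (ae_of_all _ fun _ => ENNReal.ofReal_lt_top)]
  simp [ENNReal.toReal_ofReal (hg0 _)]

theorem integrable_law_iff {g : ℝ → ℝ} (hg : Measurable g) (hg0 : ∀ x, 0 ≤ g x) (φ : ℝ → ℝ) :
    Integrable φ (law g) ↔ Integrable (fun x => g x * φ x) volume := by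
  rw [law, integrable_withDensity_iff_integrable_smul' hg.ennreal_ofReal
    (ae_of_all _ fun _ => ENNReal.ofReal_lt_top)]
  simp [ENNReal.toReal_ofReal (hg0 _)]

theorem IsDensity.isProbabilityMeasure_law {g : ℝ → ℝ} (hg : IsDensity g) :
    IsProbabilityMeasure (law g) := by
  refine ⟨?_⟩
  rw [law, withDensity_apply _ MeasurableSet.univ, Measure.restrict_univ,
    ← ofReal_integral_eq_lintegral_ofReal hg.integrable (ae_of_all _ hg.nonneg),
    hg.integral_eq_one, ENNReal.ofReal_one]

theorem law_conv_law {g h : ℝ → ℝ} (hg : IsDensity g) (hh : IsDensity h) :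
    law g ∗ law h = law fun y => ∫ s, g s * h (y - s) := by
  rw [law, law, conv_withDensity_eq_lconvolution hg.measurable.ennreal_ofReal
    hh.measurable.ennreal_ofReal, law]
  refine withDensity_congr_ae ?_
  -- The Bochner convolution can be matched with the lower integral where its integrand is
  -- integrable, which is almost everywhere.
  filter_upwards [hg.integrable.ae_convolution_exists (ContinuousLinearMap.mul ℝ ℝ) hh.integrable]
    with y hy
  have hy' : Integrable (fun s => g s * h (y - s)) volume := hy
  rw [lconvolution_def, ofReal_integral_eq_lintegral_ofReal hy'
    (ae_of_all _ fun s => mul_nonneg (hg.nonneg _) (hh.nonneg _))]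
  refine lintegral_congr fun s => ?_
  rw [ENNReal.ofReal_mul (hg.nonneg _), neg_add_eq_sub]

theorem IsDensity.convolution {g h : ℝ → ℝ} (hg : IsDensity g) (hh : IsDensity h) :
    IsDensity fun y => ∫ s, g s * h (y - s) where
  measurable := by
    have : StronglyMeasurable (Function.uncurry fun y s => g s * h (y - s)) :=
      ((hg.measurable.comp measurable_snd).mul
        (hh.measurable.comp (measurable_fst.sub measurable_snd))).stronglyMeasurable
    exact this.integral_prod_right.measurable
  nonneg y := integral_nonneg fun s => mul_nonneg (hg.nonneg _) (hh.nonneg _)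
  integrable := hg.integrable.integrable_convolution (ContinuousLinearMap.mul ℝ ℝ) hh.integrable
  integral_eq_one := by
    have := integral_convolution (μ := volume) (ν := volume) (ContinuousLinearMap.mul ℝ ℝ)
      hg.integrable hh.integrable
    rw [hg.integral_eq_one, hh.integral_eq_one] at this
    exact this.trans (by simp)

/-! ### Centering of the score -/

section Score

variable {k : ℕ} {f : EuclideanSpace ℝ (Fin k) → ℝ → ℝ} {h : ℝ → ℝ}
  {Θ : Set (EuclideanSpace ℝ (Fin k))}

theorem gradient_apply_eq_fderiv (g : EuclideanSpace ℝ (Fin k) → ℝ) (θ : EuclideanSpace ℝ (Fin k))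
    (i : Fin k) : gradient g θ i = fderiv ℝ g θ (EuclideanSpace.single i 1) := by
  rw [← inner_gradient_left, real_inner_comm, EuclideanSpace.inner_single_left]
  simp

/-- Identifies the integrand `D²/q` of the path argument with that of a diagonal Fisher entry; both
sides are `0` where the density vanishes. -/
theorem obsDensity_mul_score_sq {θ : EuclideanSpace ℝ (Fin k)}
    (hq : ∀ y, 0 ≤ obsDensity f h θ y) (i : Fin k) (y : ℝ) :
    obsDensity f h θ y * (score f h θ y i * score f h θ y i) =
      fderiv ℝ (fun η => obsDensity f h η y) θ (EuclideanSpace.single i 1) ^ 2 /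
        obsDensity f h θ y := by
  rcases (hq y).eq_or_lt with h0 | h0
  · simp [← h0]
  · rw [score, if_pos h0, PiLp.smul_apply, gradient_apply_eq_fderiv, smul_eq_mul]
    field_simp

theorem IsRegular.integral_score_eq_zero (hreg : IsRegular f h Θ) (hΘ : IsOpen Θ)
    (h0 : (0 : EuclideanSpace ℝ (Fin k)) ∈ Θ) (hf : ∀ θ ∈ Θ, IsDensity (f θ))
    (hh : IsDensity h) (i : Fin k) : ∫ y, score f h 0 y i ∂obsLaw f h 0 = 0 := by
  obtain ⟨ε, hε, hball⟩ := Metric.isOpen_iff.1 hΘ 0 h0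
  -- The sine keeps the path inside the ball for all real `t`, with nonzero velocity `ε / 2` along
  -- axis `i` at `t = 0`.
  set γ : ℝ → EuclideanSpace ℝ (Fin k) :=
    fun t => (ε / 2 * Real.sin t) • EuclideanSpace.single i 1 with hγ
  have hγΘ : ∀ t, γ t ∈ Θ := fun t => hball <| by
    rw [mem_ball_zero_iff, hγ]
    simp only [norm_smul, norm_mul, PiLp.norm_single, norm_one, mul_one, Real.norm_eq_abs]
    have := Real.abs_sin_le_one t
    rw [abs_of_pos (half_pos hε)]
    nlinarith [abs_nonneg (Real.sin t)]
  have hγ0 : γ 0 = 0 := by simp [hγ]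
  have hγc : Continuous γ := by fun_prop
  have hγd : ∀ t, HasDerivAt γ ((ε / 2 * Real.cos t) • EuclideanSpace.single i 1) t := fun t =>
    ((Real.hasDerivAt_sin t).const_mul (ε / 2)).smul_const _
  have hdens : ∀ θ ∈ Θ, IsDensity (obsDensity f h θ) := fun θ hθ => (hf θ hθ).convolution hh
  set D : ℝ → ℝ → ℝ := fun t y => (ε / 2 * Real.cos t) *
    fderiv ℝ (fun η => obsDensity f h η y) (γ t) (EuclideanSpace.single i 1) with hDdef
  have hDsq : ∀ t y, D t y ^ 2 / obsDensity f h (γ t) y = (ε / 2 * Real.cos t) ^ 2 *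
      (obsDensity f h (γ t) y * (score f h (γ t) y i * score f h (γ t) y i)) := fun t y => by
    rw [obsDensity_mul_score_sq (hdens _ (hγΘ t)).nonneg, hDdef]
    ring
  have hD : ∀ᵐ y, (∀ t, HasDerivAt (fun s => obsDensity f h (γ s) y) (D t y) t) ∧
      Continuous fun t => D t y := by
    filter_upwards [hreg.contDiffOn] with y hy
    refine ⟨fun t => ?_, ?_⟩
    · have hd := ((hy.differentiableOn (by simp)).differentiableAt
        (hΘ.mem_nhds (hγΘ t))).hasFDerivAt.comp_hasDerivAt t (hγd t)
      rwa [map_smul, smul_eq_mul] at hd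
    · have hc := (hy.continuousOn_fderiv_of_isOpen hΘ le_rfl).comp_continuous hγc hγΘ
      have : Continuous fun t => fderiv ℝ (fun η => obsDensity f h η y) (γ t)
        (EuclideanSpace.single i 1) := hc.clm_apply continuous_const
      exact (by fun_prop : Continuous fun t => ε / 2 * Real.cos t).mul this
  have hmain := integral_deriv_eq_zero_of_ae (μ := volume)
    (q := fun t => obsDensity f h (γ t)) (D := D) (c := 1)
    (fun t => (hdens _ (hγΘ t)).measurable) (fun t => (hdens _ (hγΘ t)).nonneg)
    (fun t => (hdens _ (hγΘ t)).integrable) (fun t => (hdens _ (hγΘ t)).integral_eq_one) hD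
    (fun t => ?_) ?_
  · rw [obsLaw, integral_law (hdens 0 h0).measurable (hdens 0 h0).nonneg]
    have hae : D 0 =ᵐ[volume] fun y => ε / 2 * (obsDensity f h 0 y * score f h 0 y i) := by
      filter_upwards [hD] with y hy
      -- At a zero of the density the path has a minimum, so its derivative vanishes too.
      rcases ((hdens 0 h0).nonneg y).eq_or_lt with hq | hq
      · rw [← hq, zero_mul, mul_zero]
        exact hasDerivAt_eq_zero_of_nonneg (fun s => (hdens _ (hγΘ s)).nonneg y) (hy.1 0)
          (by rw [hγ0, ← hq])
      · rw [score, if_pos hq, PiLp.smul_apply, gradient_apply_eq_fderiv, smul_eq_mul,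
          mul_inv_cancel_left₀ hq.ne', hDdef]
        simp only [hγ0, Real.cos_zero, mul_one]
    rw [integral_congr_ae hae, integral_const_mul] at hmain
    exact (mul_eq_zero.1 hmain).resolve_left (half_pos hε).ne'
  · simp only [hDsq]
    refine Integrable.const_mul ?_ _
    rw [← integrable_law_iff (hdens _ (hγΘ t)).measurable (hdens _ (hγΘ t)).nonneg
      fun y => score f h (γ t) y i * score f h (γ t) y i]
    have := (hreg.memLp_score _ (hγΘ t)).eval_piLp i
    exact this.integrable_mul this
  · have : ∀ t, ∫ y, D t y ^ 2 / obsDensity f h (γ t) y =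
        (ε / 2 * Real.cos t) ^ 2 * fisherInformation f h (γ t) i i := fun t => by
      simp only [hDsq]
      rw [integral_const_mul, fisherInformation, Matrix.of_apply, obsLaw,
        integral_law (hdens _ (hγΘ t)).measurable (hdens _ (hγΘ t)).nonneg]
    simp only [this]
    have hI : Continuous fun t => fisherInformation f h (γ t) :=
      hreg.continuousOn.comp_continuous hγc hγΘ
    exact (by fun_prop : Continuous fun t => (ε / 2 * Real.cos t) ^ 2).mul (hI.matrix_elem i i)

end Score


/-! ### Normalized sums of i.i.d. variables -/

section NormalizedSum

variable {Ω : Type*} [MeasurableSpace Ω] {P : Measure Ω}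
  {ν : Measure ℝ} {Y : ℕ → Ω → ℝ} {φ : ℝ → ℝ}

theorem integral_abs_mul_le_of_integral_sq_le {a b : ℝ} {M N : Ω → ℝ} (hM : MemLp M 2 P)
    (hN : MemLp N 2 P) (ha : ∫ ω, M ω ^ 2 ∂P ≤ a) (hb : ∫ ω, N ω ^ 2 ∂P ≤ b) :
    ∫ ω, |M ω * N ω| ∂P ≤ a + b := by
  refine le_trans ?_ (add_le_add ha hb)
  rw [← integral_add hM.integrable_sq hN.integrable_sq]
  refine integral_mono (hM.integrable_mul hN).abs (hM.integrable_sq.add hN.integrable_sq)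
    fun ω => ?_
  simp only [abs_mul]
  nlinarith [sq_abs (M ω), sq_abs (N ω), sq_nonneg (|M ω| - |N ω|), abs_nonneg (M ω),
    abs_nonneg (N ω), mul_nonneg (abs_nonneg (M ω)) (abs_nonneg (N ω))]

theorem hasLaw_memLp_comp (hY : ∀ i, HasLaw (Y i) ν P) (hφ : MemLp φ 2 ν) (i : ℕ) :
    MemLp (fun ω => φ (Y i ω)) 2 P := by
  have := (hY i).map_eq ▸ hφ
  exact (memLp_map_measure_iff this.aestronglyMeasurable (hY i).aemeasurable).1 this

theorem iIndepFun_comp_of_memLp (hY : ∀ i, HasLaw (Y i) ν P) (hind : iIndepFun Y P)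
    (hφ : MemLp φ 2 ν) : iIndepFun (fun i ω => φ (Y i ω)) P :=
  hind.comp₀ (fun _ => φ) (fun i => (hY i).aemeasurable)
    fun i => (hY i).map_eq.symm ▸ hφ.aestronglyMeasurable.aemeasurable

theorem memLp_normalizedSum (hY : ∀ i, HasLaw (Y i) ν P) (hφ : MemLp φ 2 ν) (n : ℕ) :
    MemLp (fun ω => (Real.sqrt n)⁻¹ * ∑ j ∈ Finset.range n, φ (Y j ω)) 2 P :=
  (memLp_finsetSum _ fun j _ => hasLaw_memLp_comp hY hφ j).const_mul _

variable [IsProbabilityMeasure P]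

theorem integral_normalizedSum_sq_le (hY : ∀ i, HasLaw (Y i) ν P) (hind : iIndepFun Y P)
    (hφ : MemLp φ 2 ν) (hφ0 : ∫ y, φ y ∂ν = 0) (n : ℕ) :
    ∫ ω, ((Real.sqrt n)⁻¹ * ∑ j ∈ Finset.range n, φ (Y j ω)) ^ 2 ∂P ≤ ∫ y, φ y ^ 2 ∂ν := by
  have hφY := hasLaw_memLp_comp hY hφ
  have hmean : ∀ j, ∫ ω, φ (Y j ω) ∂P = 0 := fun j =>
    ((hY j).integral_comp hφ.aestronglyMeasurable).trans hφ0
  have hvar : ∀ j, Var[fun ω => φ (Y j ω); P] = ∫ y, φ y ^ 2 ∂ν := fun j => by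
    rw [variance_of_integral_eq_zero (hφY j).aestronglyMeasurable.aemeasurable (hmean j)]
    exact (hY j).integral_comp (f := fun y => φ y ^ 2) (hφ.aestronglyMeasurable.pow 2)
  have hS : ∫ ω, (∑ j ∈ Finset.range n, φ (Y j ω)) ^ 2 ∂P = n * ∫ y, φ y ^ 2 ∂ν := by
    have h1 := IndepFun.variance_sum (X := fun j ω => φ (Y j ω)) (s := Finset.range n)
      (fun j _ => hφY j)
      (fun i _ j _ hij => (iIndepFun_comp_of_memLp hY hind hφ).indepFun hij)
    rw [variance_of_integral_eq_zero] at h1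
    · simpa [hvar] using h1
    · exact (memLp_finsetSum' _ fun j _ => hφY j).aestronglyMeasurable.aemeasurable
    · simp only [Finset.sum_apply]
      rw [integral_finsetSum _ fun j _ => (hφY j).integrable (by norm_num)]
      simp [hmean]
  simp only [mul_pow]
  rw [integral_const_mul, hS, inv_pow, Real.sq_sqrt n.cast_nonneg, ← mul_assoc]
  have hnn : 0 ≤ ∫ y, φ y ^ 2 ∂ν := integral_nonneg fun y => sq_nonneg _
  -- Equality holds for `n ≠ 0`; at `n = 0` the left side is `0`.
  rcases eq_or_ne n 0 with rfl | hn
  · simpa using hnn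
  · rw [inv_mul_cancel₀ (Nat.cast_ne_zero.2 hn), one_mul]

theorem tendsto_measure_le_of_integral_abs_le {U : ℕ → Ω → ℝ} {B : ℝ} {c : ℕ → ℝ}
    (hU : ∀ n, Integrable (U n) P) (hB : ∀ n, ∫ ω, |U n ω| ∂P ≤ B) (hc : Tendsto c atTop atTop) :
    Tendsto (fun n => P {ω | c n ≤ U n ω}) atTop (𝓝 0) := by
  have hlim : Tendsto (fun n => ENNReal.ofReal (B / c n)) atTop (𝓝 0) := by
    rw [← ENNReal.ofReal_zero]
    exact ENNReal.tendsto_ofReal (hc.const_div_atTop B)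
  refine tendsto_of_tendsto_of_tendsto_of_le_of_le' tendsto_const_nhds hlim
    (Eventually.of_forall fun _ => zero_le) ?_
  filter_upwards [hc.eventually_gt_atTop 0] with n hn
  have h1 := mul_meas_ge_le_integral_of_nonneg (ae_of_all P fun ω => abs_nonneg (U n ω))
    (hU n).abs (c n)
  calc P {ω | c n ≤ U n ω} ≤ P {ω | c n ≤ |U n ω|} :=
        measure_mono fun ω (hω : c n ≤ U n ω) => hω.trans (le_abs_self (U n ω))
    _ = ENNReal.ofReal (P.real {ω | c n ≤ |U n ω|}) := (ofReal_measureReal).symm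
    _ ≤ ENNReal.ofReal (B / c n) := by
        refine ENNReal.ofReal_le_ofReal ((le_div_iff₀' hn).2 (h1.trans (hB n)))

theorem tendstoInDistribution_normalizedSum_sq (hY : ∀ i, HasLaw (Y i) ν P) (hind : iIndepFun Y P)
    (hφ : MemLp φ 2 ν) (hφ0 : ∫ y, φ y ∂ν = 0) (hφ1 : ∫ y, φ y ^ 2 ∂ν = 1) :
    TendstoInDistribution
      (fun (n : ℕ) ω => ((Real.sqrt n)⁻¹ * ∑ j ∈ Finset.range n, φ (Y j ω)) ^ 2) atTop id
      (fun _ => P) (chiSquare 1) := by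
  have hm := hφ.aestronglyMeasurable
  have hmean : ∫ ω, φ (Y 0 ω) ∂P = 0 := ((hY 0).integral_comp hm).trans hφ0
  have hvar : ∫ ω, φ (Y 0 ω) ^ 2 ∂P = 1 :=
    ((hY 0).integral_comp (f := fun y => φ y ^ 2) (hm.pow 2)).trans hφ1
  have hident : ∀ i, IdentDistrib (fun ω => φ (Y i ω)) (fun ω => φ (Y 0 ω)) P P := fun i =>
    ((hY i).identDistrib (hY 0)).comp_of_aemeasurable (u := φ)
      ((hY i).map_eq.symm ▸ hm.aemeasurable)
  have hsq := (tendstoInDistribution_inv_sqrt_mul_sum (P := P) (X := fun i ω => φ (Y i ω))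
    -- The Gaussian limit is realized as a coordinate of this product so that its square has law
    -- `chiSquare 1` by definition.
    (P' := Measure.pi fun _ : Fin 1 => gaussianReal 0 1) (Y := fun z => z 0)
    (measurePreserving_eval (fun _ : Fin 1 => gaussianReal 0 1) 0).hasLaw
    hmean hvar (iIndepFun_comp_of_memLp hY hind hφ) hident).continuous_comp (continuous_pow 2)
  refine ⟨hsq.forall_aemeasurable, aemeasurable_id, ?_⟩
  have hlaw : (Measure.pi fun _ : Fin 1 => gaussianReal 0 1).map
      ((fun x : ℝ => x ^ 2) ∘ fun z => z 0) = (chiSquare 1).map id := by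
    simp [chiSquare, Function.comp_def]
  have h := hsq.tendsto
  simp only [hlaw] at h
  exact h

end NormalizedSum

/-! ### Measurability of the selected index and statistic -/

section Selection

theorem maximizers_congr {d : ℕ} {u v p : ℕ → ℝ} (h : ∀ k, 1 ≤ k → k ≤ d → u k = v k) :
    maximizers d u p = maximizers d v p := by
  ext k
  simp only [maximizers, Set.mem_ofPred_eq]
  refine and_congr_right fun h1 => and_congr_right fun h2 => forall_congr' fun j =>
    forall_congr' fun h3 => forall_congr' fun h4 => ?_
  rw [h k h1 h2, h j h3 h4]

theorem measurable_selection {d : ℕ} (hd : 1 ≤ d) (p : ℕ → ℝ) :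
    Measurable fun u => selection d u p := by
  have hmax : ∀ m, MeasurableSet {u | m ∈ maximizers d u p} := fun m => by
    simp only [maximizers, Set.mem_ofPred_eq]
    refine measurableSet_setOfPred.2 (measurable_const.and (measurable_const.and ?_))
    refine Measurable.forall fun j => measurable_const.imp (measurable_const.imp ?_)
    exact measurableSet_setOfPred.1 (measurableSet_le (by fun_prop) (by fun_prop))
  refine measurable_to_countable' fun m => ?_
  have : (fun u => selection d u p) ⁻¹' {m} =
      {u | m ∈ maximizers d u p} ∩ ⋂ k ∈ Set.Iio m, {u | k ∈ maximizers d u p}ᶜ := by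
    ext u
    simp only [Set.mem_preimage, Set.mem_singleton_iff, Set.mem_inter_iff, Set.mem_ofPred_eq,
      Set.mem_iInter, Set.mem_compl_iff, Set.mem_Iio]
    have hl := selection_isLeast hd u p
    constructor
    · rintro rfl
      exact ⟨hl.1, fun k hk hk' => (hl.2 hk').not_gt hk⟩
    · rintro ⟨h1, h2⟩
      by_contra hne
      exact h2 _ (lt_of_le_of_ne (hl.2 h1) hne) hl.1
  rw [this]
  exact (hmax m).inter (MeasurableSet.biInter (Set.to_countable _) fun k _ => (hmax k).compl)

theorem aemeasurable_apply_selection {Ω : Type*} [MeasurableSpace Ω] {P : Measure Ω} {d : ℕ}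
    (hd : 1 ≤ d) {U : ℕ → Ω → ℝ} (hU : ∀ k, 1 ≤ k → k ≤ d → AEMeasurable (U k) P) (p : ℕ → ℝ) :
    AEMeasurable (fun ω => U (selection d (fun k => U k ω) p) ω) P := by
  -- Measurability is known only for indices in `1, …, d`; the selection ignores the others, so they
  -- may be zeroed.
  set W : Ω → ℕ → ℝ := fun ω k => if 1 ≤ k ∧ k ≤ d then U k ω else 0 with hW
  have hWm : AEMeasurable W P := by
    refine aemeasurable_pi_iff.2 fun k => ?_
    by_cases hk : 1 ≤ k ∧ k ≤ d
    · simpa [hW, hk] using hU k hk.1 hk.2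
    · simp [hW, hk]
  have hev : Measurable fun u : ℕ → ℝ => u (selection d u p) := by
    have h1 : Measurable fun z : ℕ × (ℕ → ℝ) => z.2 z.1 :=
      measurable_from_prod_countable_right fun k => measurable_pi_apply k
    exact h1.comp ((measurable_selection hd p).prodMk measurable_id)
  refine (hev.comp_aemeasurable hWm).congr (ae_of_all _ fun ω => ?_)
  have hsel : selection d (W ω) p = selection d (fun k => U k ω) p := by
    rw [selection, selection, maximizers_congr fun k h1 h2 => if_pos ⟨h1, h2⟩]
  have hmem := (selection_isLeast hd (fun k => U k ω) p).1
  simp only [Function.comp_apply, hsel]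
  exact if_pos ⟨hmem.1, hmem.2.1⟩

end Selection

/-! ### Uniform L¹ bound for the score statistics -/

section Statistic

variable {Ω : Type*} [MeasurableSpace Ω] {P : Measure Ω}
  {k : ℕ} {f : EuclideanSpace ℝ (Fin k) → ℝ → ℝ} {h : ℝ → ℝ} {Y : ℕ → Ω → ℝ}

theorem scoreStatistic_eq_sum (n : ℕ) (y : ℕ → ℝ) :
    scoreStatistic f h n y = ∑ i, ∑ j, (fisherInformation f h 0)⁻¹ i j *
      (normalizedScore f h n y i * normalizedScore f h n y j) := by
  simp only [scoreStatistic, dotProduct, Matrix.mulVec, Finset.mul_sum]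
  refine Finset.sum_congr rfl fun i _ => Finset.sum_congr rfl fun j _ => by ring

theorem memLp_normalizedScore (hY : ∀ i, HasLaw (Y i) (obsLaw f h 0) P)
    (hs : MemLp (score f h 0) 2 (obsLaw f h 0)) (n : ℕ) (i : Fin k) :
    MemLp (fun ω => normalizedScore f h n (fun j => Y j ω) i) 2 P :=
  memLp_normalizedSum hY (hs.eval_piLp i) n

theorem integrable_scoreStatistic (hY : ∀ i, HasLaw (Y i) (obsLaw f h 0) P)
    (hs : MemLp (score f h 0) 2 (obsLaw f h 0)) (n : ℕ) :
    Integrable (fun ω => scoreStatistic f h n fun j => Y j ω) P := by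
  simp only [scoreStatistic_eq_sum]
  exact integrable_finsetSum _ fun i _ => integrable_finsetSum _ fun j _ =>
    ((memLp_normalizedScore hY hs n i).integrable_mul (memLp_normalizedScore hY hs n j)).const_mul _

/-- The quadratic form has fixed coefficients, and each product of coordinates is controlled by
second moments that do not grow with `n`. -/
theorem exists_integral_abs_scoreStatistic_le [IsProbabilityMeasure P]
    (hY : ∀ i, HasLaw (Y i) (obsLaw f h 0) P)
    (hind : iIndepFun Y P) (hs : MemLp (score f h 0) 2 (obsLaw f h 0))
    (h0 : ∀ i, ∫ y, score f h 0 y i ∂obsLaw f h 0 = 0) :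
    ∃ B, ∀ n, ∫ ω, |scoreStatistic f h n fun j => Y j ω| ∂P ≤ B := by
  set v : Fin k → ℝ := fun i => ∫ y, score f h 0 y i ^ 2 ∂obsLaw f h 0
  refine ⟨∑ i, ∑ j, |(fisherInformation f h 0)⁻¹ i j| * (v i + v j), fun n => ?_⟩
  have hN := memLp_normalizedScore hY hs n
  have hNv : ∀ i, ∫ ω, normalizedScore f h n (fun j => Y j ω) i ^ 2 ∂P ≤ v i := fun i =>
    integral_normalizedSum_sq_le hY hind (hs.eval_piLp i) (h0 i) n
  have hint : ∀ i j, Integrable (fun ω => |(fisherInformation f h 0)⁻¹ i j| *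
      |normalizedScore f h n (fun j => Y j ω) i * normalizedScore f h n (fun j => Y j ω) j|) P :=
    fun i j => ((hN i).integrable_mul (hN j)).abs.const_mul _
  calc ∫ ω, |scoreStatistic f h n fun j => Y j ω| ∂P
      ≤ ∫ ω, ∑ i, ∑ j, |(fisherInformation f h 0)⁻¹ i j| *
        |normalizedScore f h n (fun j => Y j ω) i * normalizedScore f h n (fun j => Y j ω) j| ∂P := by
        refine integral_mono (integrable_scoreStatistic hY hs n).abs
          (integrable_finsetSum _ fun i _ => integrable_finsetSum _ fun j _ => hint i j) fun ω => ?_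
        simp only [scoreStatistic_eq_sum, ← abs_mul]
        exact (Finset.abs_sum_le_sum_abs _ _).trans
          (Finset.sum_le_sum fun i _ => Finset.abs_sum_le_sum_abs _ _)
    _ = ∑ i, ∑ j, |(fisherInformation f h 0)⁻¹ i j| * ∫ ω,
        |normalizedScore f h n (fun j => Y j ω) i * normalizedScore f h n (fun j => Y j ω) j| ∂P := by
        rw [integral_finsetSum _ fun i _ => integrable_finsetSum _ fun j _ => hint i j]
        refine Finset.sum_congr rfl fun i _ => ?_
        rw [integral_finsetSum _ fun j _ => hint i j]
        simp only [integral_const_mul]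
    _ ≤ _ := Finset.sum_le_sum fun i _ => Finset.sum_le_sum fun j _ =>
        mul_le_mul_of_nonneg_left (integral_abs_mul_le_of_integral_sq_le (hN i) (hN j) (hNv i) (hNv j))
          (abs_nonneg _)

end Statistic

/-! ### Limit law in the one-parameter model -/

section OneDimensional

variable {Ω : Type*} [MeasurableSpace Ω] {P : Measure Ω} [IsProbabilityMeasure P]
  {f : EuclideanSpace ℝ (Fin 1) → ℝ → ℝ} {h : ℝ → ℝ} {Y : ℕ → Ω → ℝ}

theorem scoreStatistic_fin_one (n : ℕ) (y : ℕ → ℝ) :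
    scoreStatistic f h n y =
      (fisherInformation f h 0 0 0)⁻¹ * normalizedScore f h n y 0 ^ 2 := by
  simp [scoreStatistic_eq_sum, sq]

theorem fisherInformation_diag_nonneg {k : ℕ} (f : EuclideanSpace ℝ (Fin k) → ℝ → ℝ) (h : ℝ → ℝ)
    (θ : EuclideanSpace ℝ (Fin k)) (i : Fin k) : 0 ≤ fisherInformation f h θ i i :=
  integral_nonneg fun _ => mul_self_nonneg _

theorem tendstoInDistribution_scoreStatistic_fin_one
    (hY : ∀ i, HasLaw (Y i) (obsLaw f h 0) P) (hind : iIndepFun Y P)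
    (hs : MemLp (score f h 0) 2 (obsLaw f h 0))
    (h0 : ∫ y, score f h 0 y 0 ∂obsLaw f h 0 = 0)
    (hdet : IsUnit (fisherInformation f h 0).det) :
    TendstoInDistribution (fun n ω => scoreStatistic f h n fun j => Y j ω) atTop id (fun _ => P)
      (chiSquare 1) := by
  set v := fisherInformation f h 0 0 0 with hv
  have hv0 : 0 < v := (fisherInformation_diag_nonneg f h 0 0).lt_of_ne' (by
    simpa [Matrix.det_fin_one] using hdet)
  -- Dividing by `√v` standardizes the score, so the statistic becomes the square of a normalized
  -- sum with unit variance.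
  have hφL : MemLp (fun y => score f h 0 y 0 * (Real.sqrt v)⁻¹) 2 (obsLaw f h 0) :=
    (hs.eval_piLp 0).mul_const _
  have hlim := tendstoInDistribution_normalizedSum_sq hY hind hφL
    (by rw [integral_mul_const, h0, zero_mul]) (by
      simp only [mul_pow, inv_pow, Real.sq_sqrt hv0.le]
      rw [integral_mul_const, mul_inv_eq_one₀ hv0.ne', hv, fisherInformation, Matrix.of_apply]
      simp only [sq])
  refine hlim.congr (fun n => ae_of_all _ fun ω => ?_) ae_eq_rfl
  simp only [scoreStatistic_fin_one, normalizedScore, ← Finset.sum_mul, ← hv]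
  rw [← mul_assoc, mul_pow, inv_pow (Real.sqrt v), Real.sq_sqrt hv0.le, mul_comm]

end OneDimensional


/-! ### Observations under the null, and the theorem -/

theorem IsNullModel.hasLaw_add {Ω : Type*} [MeasurableSpace Ω] {P : Measure Ω} {f₀ h : ℝ → ℝ}
    {X ε : ℕ → Ω → ℝ} (hnull : IsNullModel P f₀ h X ε) (hf₀ : IsDensity f₀) (hh : IsDensity h)
    {k : ℕ} {f : EuclideanSpace ℝ (Fin k) → ℝ → ℝ} (hf : f 0 =ᵐ[volume] f₀) (i : ℕ) :
    HasLaw (fun ω => X i ω + ε i ω) (obsLaw f h 0) P := by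
  have := hf₀.isProbabilityMeasure_law
  have := hh.isProbabilityMeasure_law
  have hadd := (hnull.indep_signal_noise i).hasLaw_fun_add (hnull.law_signal i) (hnull.law_noise i)
  rw [law_conv_law hf₀ hh] at hadd
  have heq : obsDensity f h 0 = fun y => ∫ s, f₀ s * h (y - s) := by
    funext y
    refine integral_congr_ae ?_
    filter_upwards [hf] with s hs
    rw [hs]
  rwa [obsLaw, heq]

end ScoreDeconvolution


theorem mainTheorem5 {Ω : Type*} [MeasurableSpace Ω] (P : Measure Ω) [IsProbabilityMeasure P]
    (f₀ h : ℝ → ℝ) (hf₀ : ScoreDeconvolution.IsDensity f₀)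
    (hh : ScoreDeconvolution.IsNoiseDensity h)
    (d : ℕ) (hd : 1 ≤ d)
    (Θ : (k : ℕ) → Set (EuclideanSpace ℝ (Fin k)))
    (f : (k : ℕ) → EuclideanSpace ℝ (Fin k) → ℝ → ℝ)
    (hΘ_open : ∀ k, 1 ≤ k → k ≤ d → IsOpen (Θ k))
    (hΘ_zero : ∀ k, 1 ≤ k → k ≤ d → (0 : EuclideanSpace ℝ (Fin k)) ∈ Θ k)
    (hf : ∀ k, 1 ≤ k → k ≤ d → ∀ θ ∈ Θ k, ScoreDeconvolution.IsDensity (f k θ))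
    (hf_zero : ∀ k, 1 ≤ k → k ≤ d → f k 0 =ᵐ[volume] f₀)
    (hreg : ∀ k, 1 ≤ k → k ≤ d → ScoreDeconvolution.IsRegular (f k) h (Θ k))
    (pen : ℕ → ℕ → ℝ) (hpen : ScoreDeconvolution.IsPenalty d pen)
    (X ε : ℕ → Ω → ℝ) (hnull : ScoreDeconvolution.IsNullModel P f₀ h X ε) :
    Tendsto (fun n => P {ω | 1 < ScoreDeconvolution.selectionRule f h d pen n
        (fun i => X i ω + ε i ω)}) atTop (𝓝 0) ∧
    TendstoInDistribution (fun n ω => ScoreDeconvolution.dataDrivenStatistic f h d pen n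
        (fun i => X i ω + ε i ω)) atTop id (fun _ => P) (ScoreDeconvolution.chiSquare 1) := by
  have hhd : ScoreDeconvolution.IsDensity h := hh.toIsDensity
  have hY : ∀ k, 1 ≤ k → k ≤ d → ∀ i, HasLaw (fun ω => X i ω + ε i ω)
      (ScoreDeconvolution.obsLaw (f k) h 0) P := fun k h1 h2 =>
    hnull.hasLaw_add hf₀ hhd (hf_zero k h1 h2)
  have hind : iIndepFun (fun i ω => X i ω + ε i ω) P :=
    hnull.indep_pairs.comp (fun _ z => z.1 + z.2) fun _ => by fun_prop
  have hs : ∀ k, 1 ≤ k → k ≤ d → MemLp (ScoreDeconvolution.score (f k) h 0) 2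
      (ScoreDeconvolution.obsLaw (f k) h 0) := fun k h1 h2 =>
    (hreg k h1 h2).memLp_score 0 (hΘ_zero k h1 h2)
  have hs0 : ∀ k, 1 ≤ k → k ≤ d → ∀ i, ∫ y, ScoreDeconvolution.score (f k) h 0 y i
      ∂ScoreDeconvolution.obsLaw (f k) h 0 = 0 := fun k h1 h2 =>
    (hreg k h1 h2).integral_score_eq_zero (hΘ_open k h1 h2) (hΘ_zero k h1 h2) (hf k h1 h2) hhd
  set U : ℕ → ℕ → Ω → ℝ := fun k n ω =>
    ScoreDeconvolution.scoreStatistic (f k) h n fun i => X i ω + ε i ω with hU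
  have hUint : ∀ k, 1 ≤ k → k ≤ d → ∀ n, Integrable (U k n) P := fun k h1 h2 n =>
    ScoreDeconvolution.integrable_scoreStatistic (hY k h1 h2) (hs k h1 h2) n
  have hU1 : ∀ n ω, 0 ≤ U 1 n ω := fun n ω => by
    simp only [hU, ScoreDeconvolution.scoreStatistic_fin_one]
    exact mul_nonneg (inv_nonneg.2 (ScoreDeconvolution.fisherInformation_diag_nonneg _ _ _ _))
      (sq_nonneg _)
  have hleast := fun n ω => ScoreDeconvolution.selection_isLeast hd (fun k => U k n ω)
    (fun k => pen k n)
  have hS : Tendsto (fun n => P {ω | 1 < ScoreDeconvolution.selectionRule f h d pen n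
      (fun i => X i ω + ε i ω)}) atTop (𝓝 0) := by
    have hlim : Tendsto (fun n => ∑ k ∈ Finset.Icc 2 d, P {ω | pen k n - pen 1 n ≤ U k n ω})
        atTop (𝓝 0) := by
      rw [← Finset.sum_const_zero (s := Finset.Icc 2 d)]
      refine tendsto_finsetSum _ fun k hk => ?_
      obtain ⟨h1, h2⟩ := Finset.mem_Icc.1 hk
      obtain ⟨B, hB⟩ := ScoreDeconvolution.exists_integral_abs_scoreStatistic_le
        (hY k (by omega) h2) hind (hs k (by omega) h2) (hs0 k (by omega) h2)
      exact ScoreDeconvolution.tendsto_measure_le_of_integral_abs_le (hUint k (by omega) h2) hB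
        (hpen.tendsto_atTop k h1 h2)
    refine tendsto_of_tendsto_of_tendsto_of_le_of_le tendsto_const_nhds hlim
      (fun _ => zero_le) fun n => ?_
    refine (measure_mono ?_).trans (measure_biUnion_finset_le _ _)
    intro ω hω
    have hω' : 1 < ScoreDeconvolution.selection d (fun k => U k n ω) (fun k => pen k n) := hω
    obtain ⟨-, h2, h3⟩ := (hleast n ω).1
    refine Set.mem_biUnion (Finset.mem_coe.2 (Finset.mem_Icc.2 ⟨hω', h2⟩)) ?_
    -- The selected index beats model 1, so its statistic exceeds the penalty gap by at least `U 1 n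
    -- ω ≥ 0`.
    have h4 := h3 1 le_rfl hd
    have h5 := hU1 n ω
    rw [Set.mem_ofPred_eq]
    linarith
  refine ⟨hS, ?_⟩
  -- Slutsky: `U_S - U_1` vanishes where `S = 1`, hence tends to `0` in probability.
  refine tendstoInDistribution_of_tendstoInMeasure_sub (X := fun n ω => U 1 n ω) _ _
    (ScoreDeconvolution.tendstoInDistribution_scoreStatistic_fin_one (hY 1 le_rfl hd) hind
      (hs 1 le_rfl hd) (hs0 1 le_rfl hd 0)
      ((hreg 1 le_rfl hd).nonsingular 0 (hΘ_zero 1 le_rfl hd))) ?_ fun n =>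
    ScoreDeconvolution.aemeasurable_apply_selection hd (U := fun k ω => U k n ω)
      (fun k h1 h2 => (hUint k h1 h2 n).aestronglyMeasurable.aemeasurable) fun k => pen k n
  intro δ hδ
  refine tendsto_of_tendsto_of_tendsto_of_le_of_le tendsto_const_nhds hS
    (fun _ => zero_le) fun n => measure_mono fun ω hω => ?_
  by_contra hne
  have h1 : ScoreDeconvolution.selectionRule f h d pen n (fun i => X i ω + ε i ω) = 1 :=
    le_antisymm (not_lt.1 hne) (hleast n ω).1.1
  have h0 : δ ≤ edist (ScoreDeconvolution.dataDrivenStatistic f h d pen n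
      (fun i => X i ω + ε i ω) - U 1 n ω) 0 := hω
  rw [ScoreDeconvolution.dataDrivenStatistic, h1, sub_self, edist_self] at h0
  exact hδ.not_ge h0
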